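/- **Theorem 3 (Paley-Wiener).** Let $c\in\mathbb{R}$ and $T>0$. Then $\widetilde{B}^2_{c,T}=B^2_{c,T}$, where the two spaces are defined as follows. Let $X_c^2$ be the space of all functions $f:(0,\infty)\to\mathbb{C}$ such that $x\mapsto x^{c-1/2}f(x)$ belongs to $L^2(0,\infty)$. For $f\in X_c^2$ the $L^2$-Mellin transform $t\mapsto [f]^\wedge_{M^2}(c+it)$ is the limit in $L^2(\mathbb{R})$, as $\rho\to\infty$, of the functions $t\mapsto\int_{1/\rho}^{\rho}f(u)u^{c+it-1}\,du$. $B^2_{c,T}$ (the Mellin bandlimited functions) is the space of all continuous functions $f\in X^2_c$ such that $[f]^\wedge_{M^2}(c+it)=0$ for almost every $t$ with $|t|>T$. $\widetilde{B}^2_{c,T}$ (the Mellin-Bernstein space) is the space of all $f\in X^2_c$ for which $g(x):=x^cf(x)$ $(x>0)$ has an analytic extension $G$ to the Riemann surface of the logarithm, $\{(r,\varphi):r>0,\ \varphi\in\mathbb{R}\}$ with local coordinate $re^{i\varphi}$ and $(0,\infty)$ embedded as $\varphi=0$, whose analytic branches $g_k$ $(k\in\mathbb{Z})$ on $\Omega:=\mathbb{C}\setminus[0,\infty)$,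 $g_k(re^{i\theta})=G(r,2\pi k+\theta)$ for $r>0$, $0<\theta<2\pi$, satisfy: 1. For all $k\in\mathbb{Z}$ and $x>0$ the limits $g_k^{\pm}(x):=\lim_{\varepsilon\to0+}g_k(x\pm i\varepsilon)$ exist, $g_k^-(x)=g_{k+1}^+(x)$, and $g_0^+(x)=g(x)$. 2. For all $k\in\mathbb{Z}$, all $x>0$ and every open disk $U_x$ in the right half-plane with centre $x$, the function $\psi_k:U_x\to\mathbb{C}$ defined by $\psi_k(z)=g_k(z)$ for $\Im z<0$, $\psi_k(z)=g_k^-(z)$ for $z\in\mathbb{R}$, and $\psi_k(z)=g_{k+1}(z)$ for $\Im z>0$ is analytic. 3. There is a constant $C>0$ such that $|g_k(re^{i\theta})|\le C e^{T|2\pi k+\theta|}$ for all $k\in\mathbb{Z}$, $\theta\in[0,2\pi]$ and $r>0$. 4. For each $k\in\mathbb{Z}$, $\lim_{r\to0+}g_k(re^{i\theta})=\lim_{r\to\infty}g_k(re^{i\theta})=0$, uniformly with respect to $\theta\in[0,2\pi]$. In 3 and 4, the value $g_k(re^{i\theta})$ is read as $g_k^+(r)$ when $\theta=0$ and as $g_k^-(r)$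 when $\theta=2\pi$. -/

import Mathlib

noncomputable section

open MeasureTheory Filter Topology Set

namespace MellinPW

/-!  Functions on the positive half-line are represented, as for Mathlib's `mellin`, by functions
`f : ℝ → ℂ`; only the values of `f` on `Set.Ioi 0` enter the definitions below. -/

/-- `f ∈ X²_c`: the function `x ↦ x ^ (c - 1/2) * f x` belongs to `L²(0, ∞)`. -/
def MemX2 (c : ℝ) (f : ℝ → ℂ) : Prop :=
  MemLp (fun x : ℝ => ((x ^ (c - 1 / 2) : ℝ) : ℂ) * f x) 2 (volume.restrict (Ioi (0 : ℝ)))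

/-- `t ↦ F t` is the `L²`-Mellin transform of `f` on the line `c + i t`: it is the limit in `L²(ℝ)`
of the truncated Mellin integrals over `[1/ρ, ρ]` as `ρ → ∞`. As an `L²`-limit, `F` is
determined by `f` up to equality almost everywhere. -/
def IsMellinL2 (c : ℝ) (f : ℝ → ℂ) (F : ℝ → ℂ) : Prop :=
  MemLp F 2 (volume : Measure ℝ) ∧
    Tendsto
      (fun ρ : ℝ => eLpNorm
        (fun t : ℝ => F t -
          ∫ u in (1 / ρ)..ρ, f u * (u : ℂ) ^ ((c : ℂ) + (t : ℂ) * Complex.I - 1))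
        2 (volume : Measure ℝ))
      atTop (𝓝 0)

/-- The space `B²_{c,T}` of Mellin bandlimited functions: continuous functions in `X²_c` whose
`L²`-Mellin transform vanishes for almost every `t` with `|t| > T`. -/
def bandlimited (c T : ℝ) : Set (ℝ → ℂ) :=
  {f | MemX2 c f ∧ ContinuousOn f (Ioi (0 : ℝ)) ∧
    ∃ F : ℝ → ℂ, IsMellinL2 c f F ∧ ∀ᵐ t : ℝ, T < |t| → F t = 0}

/-- The Riemann surface of the logarithm: its points are the pairs `(r, φ)` with `r > 0` and an
unrestricted argument `φ ∈ ℝ`, with the topology of `(0, ∞) × ℝ`. -/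
abbrev LogSurface : Type := {p : ℝ × ℝ // 0 < p.1}

/-- The point `(r, φ)` of the surface. -/
def LogSurface.point (r φ : ℝ) (hr : 0 < r) : LogSurface := ⟨(r, φ), hr⟩

/-- The covering map `(r, φ) ↦ r e^{iφ}` onto `ℂ ∖ {0}`. It is a local homeomorphism, and its local
inverses are the charts of the complex structure of the surface. -/
def LogSurface.proj (p : LogSurface) : ℂ :=
  (p.1.1 : ℂ) * Complex.exp ((p.1.2 : ℂ) * Complex.I)

/-- `G` is analytic on the Riemann surface of the logarithm: near each point it is an analytic
function of the local coordinate `r e^{iφ}`. -/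
def LogSurface.IsAnalytic (G : LogSurface → ℂ) : Prop :=
  ∀ p : LogSurface, ∃ ψ : ℂ → ℂ,
    AnalyticAt ℂ ψ p.proj ∧ ∀ᶠ q : LogSurface in 𝓝 p, G q = ψ q.proj

/-- The slit plane `Ω = ℂ ∖ [0, ∞)`. -/
def Omega : Set ℂ := {z : ℂ | ¬ (0 ≤ z.re ∧ z.im = 0)}

/-- The function `ψ_k` glueing the branch `a = g_k` (below the positive axis), its boundary values
`b = g_k⁻` (on the axis) and the next branch `a' = g_{k+1}` (above the axis). -/
def glue (a : ℂ → ℂ) (b : ℝ → ℂ) (a' : ℂ → ℂ) (z : ℂ) : ℂ :=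
  if z.im < 0 then a z else if z.im = 0 then b z.re else a' z

/-- The value `a (r e^{iθ})`, `θ ∈ [0, 2π]`, of a branch `a` on the slit plane, read as the upper
boundary value `ap r` when `θ = 0` and as the lower boundary value `am r` when `θ = 2π`. -/
def polarValue (a : ℂ → ℂ) (ap am : ℝ → ℂ) (r θ : ℝ) : ℂ :=
  if θ = 0 then ap r else if θ = 2 * Real.pi then am r
  else a ((r : ℂ) * Complex.exp ((θ : ℂ) * Complex.I))

/-- `G` is an analytic extension of `x ↦ x ^ c * f x` to the Riemann surface of the logarithm,
`g k` are its branches on the slit plane, `gp k` and `gm k` their upper and lower boundary values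
on the positive axis, and these have the properties required in the Mellin-Bernstein space. -/
structure IsBernsteinExtension (c T : ℝ) (f : ℝ → ℂ) (G : LogSurface → ℂ)
    (g : ℤ → ℂ → ℂ) (gp gm : ℤ → ℝ → ℂ) : Prop where
  analytic : LogSurface.IsAnalytic G
  extends_g : ∀ (x : ℝ) (hx : 0 < x),
    G (LogSurface.point x 0 hx) = ((x ^ c : ℝ) : ℂ) * f x
  branch : ∀ (k : ℤ) (r θ : ℝ) (hr : 0 < r), 0 < θ → θ < 2 * Real.pi →
    g k ((r : ℂ) * Complex.exp ((θ : ℂ) * Complex.I))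
      = G (LogSurface.point r (2 * Real.pi * k + θ) hr)
  branch_analytic : ∀ k : ℤ, AnalyticOnNhd ℂ (g k) Omega
  tendsto_upper : ∀ (k : ℤ) (x : ℝ), 0 < x →
    Tendsto (fun ε : ℝ => g k ((x : ℂ) + (ε : ℂ) * Complex.I)) (𝓝[>] 0) (𝓝 (gp k x))
  tendsto_lower : ∀ (k : ℤ) (x : ℝ), 0 < x →
    Tendsto (fun ε : ℝ => g k ((x : ℂ) - (ε : ℂ) * Complex.I)) (𝓝[>] 0) (𝓝 (gm k x))
  lower_eq_upper : ∀ (k : ℤ) (x : ℝ), 0 < x → gm k x = gp (k + 1) x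
  upper_zero : ∀ x : ℝ, 0 < x → gp 0 x = ((x ^ c : ℝ) : ℂ) * f x
  /-- The open disks in the right half-plane with centre `x` are those of radius at most `x`. -/
  glue_analytic : ∀ (k : ℤ) (x δ : ℝ), 0 < δ → δ ≤ x →
    AnalyticOnNhd ℂ (glue (g k) (gm k) (g (k + 1))) (Metric.ball (x : ℂ) δ)
  growth : ∃ C : ℝ, 0 < C ∧ ∀ (k : ℤ) (θ : ℝ), θ ∈ Icc 0 (2 * Real.pi) → ∀ r : ℝ, 0 < r →
    ‖polarValue (g k) (gp k) (gm k) r θ‖ ≤ C * Real.exp (T * |2 * Real.pi * k + θ|)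
  decay_zero : ∀ k : ℤ,
    TendstoUniformlyOn (fun r θ : ℝ => polarValue (g k) (gp k) (gm k) r θ) (fun _ => 0)
      (𝓝[>] 0) (Icc 0 (2 * Real.pi))
  decay_top : ∀ k : ℤ,
    TendstoUniformlyOn (fun r θ : ℝ => polarValue (g k) (gp k) (gm k) r θ) (fun _ => 0)
      atTop (Icc 0 (2 * Real.pi))

/-- The Mellin-Bernstein space. -/
def mellinBernstein (c T : ℝ) : Set (ℝ → ℂ) :=
  {f | MemX2 c f ∧ ∃ (G : LogSurface → ℂ) (g : ℤ → ℂ → ℂ) (gp gm : ℤ → ℝ → ℂ),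
    IsBernsteinExtension c T f G g gp gm}

end MellinPW

end

/-!
The substitution `x = e^s` turns the statement into the classical Paley-Wiener theorem. For
`f ∈ X²_c` the function `h(s) = e^{cs} f(e^s)` (`logPullback`) lies in `L²(ℝ)`, and the `L²`-Mellin
transform of `f` on the line `c + it` is the inverse `L²`-Fourier transform of `h` at `t / 2π`
(`isMellinL2_fourierInv`, with uniqueness in `IsMellinL2.ae_eq`). The logarithm identifies its Riemann
surface with `ℂ`, so an analytic extension `G` of `x ^ c f(x)` is an entire extension
`H(s + iφ) = G(e^s, φ)` of `h`, and the growth condition reads `‖H z‖ ≤ C e^{T |Im z|}`.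

If `f` is bandlimited, `h` is the Fourier transform of an integrable `Φ` supported in `2π|w| ≤ T`
(`exists_complexFourier_of_bandlimited`). The Fourier integral of `Φ` at complex frequencies is entire,
has the required growth, and tends to zero uniformly on horizontal strips by the Riemann-Lebesgue
lemma and a bound on its derivative (`tendstoUniformlyOn_complexFourier`). Read in the logarithmic
coordinate it gives the extension `G`; on the right half-plane all branches and their boundary values
are `H(Log z + 2πik)`, from which the gluing conditions follow (`isBernsteinExtension_of_entire`).

Conversely, let `H` be entire with `‖H z‖ ≤ C e^{T |Im z|}` and `h = H|ℝ` in `L²`. Multiplying by the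
Gaussian `e^{-z²/n²}` and shifting the contour of the inverse Fourier integral to `Im z = ± n` bounds
it by a constant times `n e^{-(2π|w| - T) n}` (`norm_fourierInv_gaussian_mul_le`), which tends to zero
for `2π|w| > T`. Since the regularized functions converge to `h` in `L²`, so do their transforms, and
the transform of `h` vanishes almost everywhere outside the band
(`fourierInv_ae_eq_zero_of_exponential_type`).
-/

noncomputable section

open MeasureTheory Filter Topology Set

namespace MellinPW

open scoped FourierTransform ENNReal

/-! ### The Fourier transform on `L²(ℝ)` -/

theorem continuous_innerₗ : Continuous fun p : ℝ × ℝ => innerₗ ℝ p.1 p.2 :=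
  continuous_inner (𝕜 := ℝ) (E := ℝ)

theorem continuous_neg_innerₗ : Continuous fun p : ℝ × ℝ => (-innerₗ ℝ) p.1 p.2 :=
  continuous_innerₗ.neg

theorem continuous_fourierInv {g : ℝ → ℂ} (hg : Integrable g) : Continuous (𝓕⁻ g) :=
  VectorFourier.fourierIntegral_continuous (L := -innerₗ ℝ) Real.continuous_fourierChar
    continuous_neg_innerₗ hg

theorem continuous_fourier {g : ℝ → ℂ} (hg : Integrable g) : Continuous (𝓕 g) :=
  VectorFourier.fourierIntegral_continuous (L := innerₗ ℝ) Real.continuous_fourierChar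
    continuous_innerₗ hg

/-- An `L²` function whose pairing with every Schwartz function agrees with that of a continuous
function is almost everywhere equal to it. -/
theorem ae_eq_of_schwartz_pairing {u v : ℝ → ℂ} (hu : MemLp u 2) (hv : Continuous v)
    (h : ∀ φ : SchwartzMap ℝ ℂ, ∫ x, φ x • u x = ∫ x, φ x • v x) : u =ᵐ[volume] v := by
  refine ae_eq_of_integral_contDiff_smul_eq (hu.locallyIntegrable (by norm_num))
    hv.locallyIntegrable fun g hg hc => ?_
  have hg₁ : HasCompactSupport (Complex.ofRealCLM ∘ g) := hc.comp_left rfl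
  have hg₂ : ContDiff ℝ (⊤ : ℕ∞) (Complex.ofRealCLM ∘ g) := by fun_prop
  simpa using h (hg₁.toSchwartzMap hg₂)

/-- On `L¹ ∩ L²` the Fourier transform of `L²` is given by the Fourier integral. -/
theorem coeFn_fourier_toLp {g : ℝ → ℂ} (h1 : Integrable g) (h2 : MemLp g 2) :
    (𝓕 (h2.toLp g) : Lp ℂ 2 (volume : Measure ℝ)) =ᵐ[volume] 𝓕 g := by
  refine ae_eq_of_schwartz_pairing (Lp.memLp _) (continuous_fourier h1) fun φ => ?_
  have e := DFunLike.congr_fun (Lp.fourier_toTemperedDistribution_eq (h2.toLp g)) φ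
  rw [TemperedDistribution.fourier_apply, Lp.toTemperedDistribution_apply,
    Lp.toTemperedDistribution_apply] at e
  rw [← e]
  have e2 : ∫ x, (𝓕 φ) x • (h2.toLp g) x = ∫ x, (𝓕 φ) x • g x := by
    refine integral_congr_ae ?_
    filter_upwards [h2.coeFn_toLp] with x hx
    rw [hx]
  rw [e2, SchwartzMap.fourier_coe]
  have := VectorFourier.integral_fourierIntegral_smul_eq_flip (L := innerₗ ℝ)
    Real.continuous_fourierChar continuous_innerₗ
    (φ.integrable (μ := volume)) h1
  rwa [flip_innerₗ] at this

/-- On `L¹ ∩ L²` the inverse Fourier transform of `L²` is given by the inverse Fourier integral. -/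
theorem coeFn_fourierInv_toLp {g : ℝ → ℂ} (h1 : Integrable g) (h2 : MemLp g 2) :
    (𝓕⁻ (h2.toLp g) : Lp ℂ 2 (volume : Measure ℝ)) =ᵐ[volume] 𝓕⁻ g := by
  refine ae_eq_of_schwartz_pairing (Lp.memLp _) (continuous_fourierInv h1) fun φ => ?_
  have e := DFunLike.congr_fun (Lp.fourierInv_toTemperedDistribution_eq (h2.toLp g)) φ
  rw [TemperedDistribution.fourierInv_apply, Lp.toTemperedDistribution_apply,
    Lp.toTemperedDistribution_apply] at e
  rw [← e]
  have e2 : ∫ x, (𝓕⁻ φ) x • (h2.toLp g) x = ∫ x, (𝓕⁻ φ) x • g x := by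
    refine integral_congr_ae ?_
    filter_upwards [h2.coeFn_toLp] with x hx
    rw [hx]
  rw [e2, SchwartzMap.fourierInv_coe]
  have := VectorFourier.integral_fourierIntegral_smul_eq_flip (L := -innerₗ ℝ)
    Real.continuous_fourierChar continuous_neg_innerₗ
    (φ.integrable (μ := volume)) h1
  have e3 : (-innerₗ ℝ : ℝ →ₗ[ℝ] ℝ →ₗ[ℝ] ℝ).flip = -innerₗ ℝ := by
    ext; simp
  rw [e3] at this
  exact this

/-- Dominated convergence in `L²` for multipliers bounded by `1` that tend to `1`. -/
theorem tendsto_eLpNorm_sub_mul {ι : Type*} {l : Filter ι} [l.IsCountablyGenerated]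
    {h : ℝ → ℂ} (hh : MemLp h 2) {m : ι → ℝ → ℂ} (hm : ∀ i, Measurable (m i))
    (hb : ∀ i x, ‖m i x‖ ≤ 1) (hlim : ∀ x, Tendsto (fun i => m i x) l (𝓝 1)) :
    Tendsto (fun i => eLpNorm (fun x => h x - m i x * h x) 2 volume) l (𝓝 0) := by
  have key : Tendsto (fun i => ∫⁻ x, ‖h x - m i x * h x‖ₑ ^ (2 : ℝ)) l (𝓝 0) := by
    have h0 : (0 : ℝ≥0∞) = ∫⁻ _ : ℝ, 0 := by simp
    rw [h0]
    refine tendsto_lintegral_filter_of_dominated_convergence'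
      (fun x => (2 * ‖h x‖ₑ) ^ (2 : ℝ)) ?_ ?_ ?_ ?_
    · refine Eventually.of_forall fun i => ?_
      have := hh.1.sub ((hm i).aestronglyMeasurable.mul hh.1)
      exact this.enorm.pow_const _
    · refine Eventually.of_forall fun i => Eventually.of_forall fun x => ?_
      refine ENNReal.rpow_le_rpow ?_ (by norm_num)
      rw [← ofReal_norm, ← ofReal_norm, ← ENNReal.ofReal_ofNat 2,
        ← ENNReal.ofReal_mul (by norm_num)]
      refine ENNReal.ofReal_le_ofReal ?_
      calc ‖h x - m i x * h x‖ ≤ ‖h x‖ + ‖m i x * h x‖ := norm_sub_le _ _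
        _ ≤ ‖h x‖ + 1 * ‖h x‖ := by
          rw [norm_mul]; gcongr; exact hb i x
        _ = 2 * ‖h x‖ := by ring
    · have e : ‖(2 : ℂ)‖ₑ = 2 := by
        rw [← ofReal_norm]; simp
      have := (eLpNorm_lt_top_iff_lintegral_rpow_enorm_lt_top (p := 2) (by norm_num)
        (by norm_num)).1 (hh.const_mul 2).2
      simpa [enorm_mul, e] using this.ne
    · refine Eventually.of_forall fun x => ?_
      have h1 : Tendsto (fun i => h x - m i x * h x) l (𝓝 0) := by
        simpa using ((hlim x).mul_const (h x)).const_sub (h x)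
      have h2 := (h1.enorm).ennrpow_const (2 : ℝ)
      simpa using h2
  have := key.ennrpow_const (1 / 2 : ℝ)
  simp only [eLpNorm_eq_lintegral_rpow_enorm_toReal (p := 2) (by norm_num : (2 : ℝ≥0∞) ≠ 0)
    (by norm_num)]
  simpa using this

/-- If `L²` functions `g i` tend to `h`, their inverse Fourier transforms tend to that of `h`. -/
theorem tendsto_eLpNorm_fourierInv {ι : Type*} {l : Filter ι} {h : ℝ → ℂ} (hh : MemLp h 2)
    {g : ι → ℝ → ℂ} (h1 : ∀ i, Integrable (g i)) (h2 : ∀ i, MemLp (g i) 2)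
    (hl : Tendsto (fun i => eLpNorm (fun x => h x - g i x) 2 volume) l (𝓝 0)) :
    Tendsto (fun i => eLpNorm (fun x => (𝓕⁻ (hh.toLp h) : Lp ℂ 2 (volume : Measure ℝ)) x
      - 𝓕⁻ (g i) x) 2 volume) l (𝓝 0) := by
  refine hl.congr fun i => ?_
  have e1 : eLpNorm (fun x => h x - g i x) 2 volume = ‖hh.toLp h - (h2 i).toLp (g i)‖ₑ := by
    rw [← MemLp.toLp_sub, Lp.enorm_toLp]; rfl
  have e2 : (fun x => (𝓕⁻ (hh.toLp h) : Lp ℂ 2 (volume : Measure ℝ)) x - 𝓕⁻ (g i) x)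
      =ᵐ[volume] (𝓕⁻ (hh.toLp h - (h2 i).toLp (g i)) : Lp ℂ 2 (volume : Measure ℝ)) := by
    have e3 : (𝓕⁻ (hh.toLp h - (h2 i).toLp (g i)) : Lp ℂ 2 (volume : Measure ℝ))
        = 𝓕⁻ (hh.toLp h) - 𝓕⁻ ((h2 i).toLp (g i)) :=
      map_sub (Lp.fourierTransformₗᵢ ℝ ℂ).symm _ _
    rw [e3]
    filter_upwards [coeFn_fourierInv_toLp (h1 i) (h2 i),
      Lp.coeFn_sub (𝓕⁻ (hh.toLp h) : Lp ℂ 2 (volume : Measure ℝ)) (𝓕⁻ ((h2 i).toLp (g i)))]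
      with x hx hx'
    rw [hx', Pi.sub_apply, hx]
  rw [e1, eLpNorm_congr_ae e2, ← Lp.enorm_def]
  exact ((Lp.fourierTransformₗᵢ ℝ ℂ).symm.enorm_map _).symm

/-! ### The `L²`-Mellin transform as a Fourier transform -/

/-- The function `s ↦ e^{cs} f(e^s)` that corresponds to `f` under the substitution `x = e^s`. -/
def logPullback (c : ℝ) (f : ℝ → ℂ) (s : ℝ) : ℂ := ((Real.exp (c * s) : ℝ) : ℂ) * f (Real.exp s)

theorem continuous_logPullback {c : ℝ} {f : ℝ → ℂ} (hf : ContinuousOn f (Ioi 0)) :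
    Continuous (logPullback c f) := by
  have : Continuous fun s => f (Real.exp s) :=
    hf.comp_continuous Real.continuous_exp fun s => Real.exp_pos s
  unfold logPullback
  exact (Complex.continuous_ofReal.comp (by fun_prop)).mul this

/-- For continuous `f`, membership in `X²_c` gives `e^{cs} f(e^s) ∈ L²(ℝ)`. -/
theorem memLp_logPullback {c : ℝ} {f : ℝ → ℂ} (hf : ContinuousOn f (Ioi 0)) (h : MemX2 c f) :
    MemLp (logPullback c f) 2 := by
  refine ⟨(continuous_logPullback hf).aestronglyMeasurable, ?_⟩
  have h2 := h.2
  rw [eLpNorm_lt_top_iff_lintegral_rpow_enorm_lt_top (by norm_num) (by norm_num)] at h2 ⊢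
  have e := lintegral_image_eq_lintegral_abs_deriv_mul (s := univ) MeasurableSet.univ
    (fun x _ => (Real.hasDerivAt_exp x).hasDerivWithinAt) Real.exp_injective.injOn
    (fun x : ℝ => ‖((x ^ (c - 1 / 2) : ℝ) : ℂ) * f x‖ₑ ^ (ENNReal.toReal 2))
  rw [image_univ, Real.range_exp] at e
  rw [e, Measure.restrict_univ] at h2
  refine lt_of_le_of_lt (le_of_eq (lintegral_congr fun s => ?_)) h2
  have e1 : Real.exp s ^ (c - 1 / 2) = Real.exp (c * s) * Real.exp (-(s / 2)) := by
    rw [← Real.exp_mul, ← Real.exp_add]; ring_nf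
  have e2 : ENNReal.ofReal |Real.exp s|
      * ‖((Real.exp (-(s / 2)) : ℝ) : ℂ)‖ₑ ^ (2 : ℝ) = 1 := by
    rw [← ofReal_norm, Complex.norm_real, Real.norm_of_nonneg (Real.exp_pos _).le,
      ENNReal.ofReal_rpow_of_nonneg (Real.exp_pos _).le (by norm_num),
      ← ENNReal.ofReal_mul (abs_nonneg _), abs_of_pos (Real.exp_pos _), ← Real.exp_mul,
      ← Real.exp_add]
    ring_nf; simp
  simp only [ENNReal.toReal_ofNat, e1, Complex.ofReal_mul, enorm_mul, logPullback]
  rw [ENNReal.mul_rpow_of_nonneg _ _ (by norm_num), ENNReal.mul_rpow_of_nonneg _ _ (by norm_num),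
    ENNReal.mul_rpow_of_nonneg _ _ (by norm_num)]
  calc _ = 1 * (‖((Real.exp (c * s) : ℝ) : ℂ)‖ₑ ^ (2 : ℝ) * ‖f (Real.exp s)‖ₑ ^ (2 : ℝ)) := by
        rw [one_mul]
    _ = _ := by rw [← e2]; ring

theorem integrable_indicator_mul {h : ℝ → ℂ} (hh : MemLp h 2) (a b : ℝ) :
    Integrable fun s => (Ioc a b).indicator 1 s * h s := by
  have := (integrable_indicator_iff measurableSet_Ioc).2
    ((hh.restrict (Ioc a b)).integrable (by norm_num))
  refine this.congr (Eventually.of_forall fun s => ?_)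
  by_cases hs : s ∈ Ioc a b <;> simp [hs]

/-- The truncated Mellin integral over `[1/ρ, ρ]` is an inverse Fourier integral over
`(-log ρ, log ρ]`. -/
theorem truncated_mellin_eq (c : ℝ) (f : ℝ → ℂ) {ρ : ℝ} (hρ : 1 ≤ ρ) (t : ℝ) :
    ∫ u in (1 / ρ)..ρ, f u * (u : ℂ) ^ ((c : ℂ) + (t : ℂ) * Complex.I - 1)
      = 𝓕⁻ (fun s => (Ioc (-Real.log ρ) (Real.log ρ)).indicator 1 s * logPullback c f s)
        (t / (2 * Real.pi)) := by
  have hρ0 : 0 < ρ := by linarith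
  have hle : 1 / ρ ≤ ρ := by
    rw [div_le_iff₀ hρ0]; nlinarith
  have him : Real.exp '' Ioc (-Real.log ρ) (Real.log ρ) = Ioc (1 / ρ) ρ := by
    ext u
    constructor
    · rintro ⟨s, hs, rfl⟩
      have h1 := Real.exp_lt_exp.2 hs.1
      have h2 := Real.exp_le_exp.2 hs.2
      rw [Real.exp_neg, Real.exp_log hρ0] at h1
      rw [Real.exp_log hρ0] at h2
      exact ⟨by simpa using h1, h2⟩
    · rintro ⟨h1, h2⟩
      have hu : 0 < u := lt_trans (by positivity) h1
      refine ⟨Real.log u, ⟨?_, Real.log_le_log hu h2⟩, Real.exp_log hu⟩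
      rw [← Real.log_inv]
      exact Real.log_lt_log (by positivity) (by simpa using h1)
  rw [intervalIntegral.integral_of_le hle, ← him, integral_image_eq_integral_abs_deriv_smul
    measurableSet_Ioc (fun x _ => (Real.hasDerivAt_exp x).hasDerivWithinAt)
    Real.exp_injective.injOn, Real.fourierInv_eq', ← integral_indicator measurableSet_Ioc]
  refine integral_congr_ae (Eventually.of_forall fun s => ?_)
  by_cases hs : s ∈ Ioc (-Real.log ρ) (Real.log ρ)
  · simp only [indicator_of_mem hs, logPullback, Pi.one_apply, one_mul, abs_of_pos (Real.exp_pos s),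
      smul_eq_mul, Complex.real_smul]
    rw [Complex.cpow_def_of_ne_zero (by simp [Complex.exp_ne_zero]), ← Complex.ofReal_log
      (Real.exp_pos s).le, Real.log_exp]
    have hpi : (Real.pi : ℂ) ≠ 0 := by exact_mod_cast Real.pi_ne_zero
    have e : Complex.exp (s : ℂ) * Complex.exp (s * (c + t * Complex.I - 1))
        = Complex.exp (((2 * Real.pi * inner ℝ s (t / (2 * Real.pi)) : ℝ) : ℂ) * Complex.I)
          * Complex.exp ((c : ℂ) * s) := by
      rw [← Complex.exp_add, ← Complex.exp_add]
      congr 1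
      simp only [RCLike.inner_apply, conj_trivial]
      push_cast
      field_simp
      ring
    push_cast at e ⊢
    calc _ = f (Real.exp s) * (Complex.exp (s : ℂ) * Complex.exp (s * (c + t * Complex.I - 1))) := by
          ring
      _ = _ := by rw [e]; ring
  · simp [indicator_of_notMem hs]

theorem quasiMeasurePreserving_mul_const {a : ℝ} (ha : a ≠ 0) :
    Measure.QuasiMeasurePreserving (fun x : ℝ => x * a) volume volume := by
  refine ⟨by fun_prop, ?_⟩
  rw [Real.map_volume_mul_right ha]
  exact Measure.smul_absolutelyContinuous

theorem eLpNorm_comp_div_two_pi (g : ℝ → ℂ) :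
    eLpNorm (fun t => g (t / (2 * Real.pi))) 2 volume
      = ENNReal.ofReal (2 * Real.pi) ^ (1 / 2 : ℝ) * eLpNorm g 2 volume := by
  have hpi : (2 * Real.pi) ≠ 0 := by positivity
  let e : ℝ ≃ᵐ ℝ := (Homeomorph.mulRight₀ (2 * Real.pi)⁻¹ (inv_ne_zero hpi)).toMeasurableEquiv
  have h1 : Measure.map e volume = ENNReal.ofReal (2 * Real.pi) • (volume : Measure ℝ) := by
    have := Real.map_volume_mul_right (inv_ne_zero hpi)
    rw [inv_inv, abs_of_pos (by positivity)] at this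
    exact this
  have h2 := e.measurableEmbedding.eLpNorm_map_measure (μ := volume) (g := g) (p := 2)
  rw [h1, eLpNorm_smul_measure_of_ne_top (by norm_num)] at h2
  simpa [div_eq_mul_inv, Function.comp_def, e] using h2.symm

/-- The `L²`-Mellin transform is the inverse Fourier transform of `e^{cs} f(e^s)`, rescaled. -/
theorem isMellinL2_fourierInv {c : ℝ} {f : ℝ → ℂ} (hh : MemLp (logPullback c f) 2) :
    IsMellinL2 c f fun t => (𝓕⁻ (hh.toLp _) : Lp ℂ 2 (volume : Measure ℝ)) (t / (2 * Real.pi)) := by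
  have hpi : (2 * Real.pi) ≠ 0 := by positivity
  constructor
  · refine ⟨?_, ?_⟩
    · exact (Lp.aestronglyMeasurable _).comp_quasiMeasurePreserving
        (quasiMeasurePreserving_mul_const (inv_ne_zero hpi))
    · rw [eLpNorm_comp_div_two_pi]
      exact ENNReal.mul_lt_top (ENNReal.rpow_lt_top_of_nonneg (by norm_num) ENNReal.ofReal_ne_top)
        (Lp.memLp _).2
  · have hm : ∀ ρ : ℝ, Measurable fun s : ℝ =>
        (Ioc (-Real.log ρ) (Real.log ρ)).indicator (1 : ℝ → ℂ) s := fun ρ =>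
      measurable_const.indicator measurableSet_Ioc
    have hb : ∀ ρ s : ℝ, ‖(Ioc (-Real.log ρ) (Real.log ρ)).indicator (1 : ℝ → ℂ) s‖ ≤ 1 :=
      fun ρ s => by
        by_cases hs : s ∈ Ioc (-Real.log ρ) (Real.log ρ) <;> simp [hs]
    have h2 : ∀ ρ : ℝ, MemLp (fun s => (Ioc (-Real.log ρ) (Real.log ρ)).indicator 1 s
        * logPullback c f s) 2 := fun ρ =>
      hh.of_le ((hm ρ).aestronglyMeasurable.mul hh.1) (Eventually.of_forall fun s => by
        rw [norm_mul]; exact mul_le_of_le_one_left (norm_nonneg _) (hb ρ s))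
    have h1 : ∀ ρ : ℝ, Integrable (fun s => (Ioc (-Real.log ρ) (Real.log ρ)).indicator 1 s
        * logPullback c f s) := fun ρ => integrable_indicator_mul hh _ _
    have hlim : ∀ s : ℝ, Tendsto (fun ρ : ℝ =>
        (Ioc (-Real.log ρ) (Real.log ρ)).indicator (1 : ℝ → ℂ) s) atTop (𝓝 1) := fun s => by
      refine tendsto_const_nhds.congr' ?_
      filter_upwards [Real.tendsto_log_atTop.eventually_gt_atTop |s|] with ρ hρ
      have := abs_lt.1 hρ
      have hs : s ∈ Ioc (-Real.log ρ) (Real.log ρ) := ⟨this.1, this.2.le⟩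
      simp [hs]
    have key := tendsto_eLpNorm_fourierInv hh h1 h2 (tendsto_eLpNorm_sub_mul hh hm hb hlim)
    have key2 := ENNReal.Tendsto.const_mul (a := ENNReal.ofReal (2 * Real.pi) ^ (1 / 2 : ℝ)) key
      (Or.inr (ENNReal.rpow_ne_top_of_nonneg (by norm_num) ENNReal.ofReal_ne_top))
    rw [mul_zero] at key2
    refine key2.congr' ?_
    filter_upwards [eventually_ge_atTop 1] with ρ hρ
    rw [← eLpNorm_comp_div_two_pi]
    simp only [truncated_mellin_eq c f hρ]

theorem IsMellinL2.ae_eq {c : ℝ} {f : ℝ → ℂ} (hh : MemLp (logPullback c f) 2) {F F' : ℝ → ℂ}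
    (h : IsMellinL2 c f F) (h' : IsMellinL2 c f F') : F =ᵐ[volume] F' := by
  have hmeas : ∀ᶠ ρ : ℝ in atTop, AEStronglyMeasurable (fun t : ℝ =>
      ∫ u in (1 / ρ)..ρ, f u * (u : ℂ) ^ ((c : ℂ) + (t : ℂ) * Complex.I - 1)) volume := by
    filter_upwards [eventually_ge_atTop 1] with ρ hρ
    simp only [truncated_mellin_eq c f hρ]
    exact ((continuous_fourierInv (integrable_indicator_mul hh _ _)).comp (by fun_prop)).aestronglyMeasurable
  have hsum := h.2.add h'.2
  rw [add_zero] at hsum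
  have hz : eLpNorm (F - F') 2 volume ≤ 0 := by
    refine ge_of_tendsto hsum ?_
    filter_upwards [hmeas] with ρ hρ
    have := eLpNorm_sub_le (h.1.1.sub hρ) (h'.1.1.sub hρ) (p := 2) (by norm_num)
    refine le_trans (le_of_eq ?_) this
    congr 1
    ext t
    simp
  have := (eLpNorm_eq_zero_iff (h.1.1.sub h'.1.1) (by norm_num)).1 (le_antisymm hz bot_le)
  filter_upwards [this] with t ht
  exact sub_eq_zero.1 ht

/-! ### Fourier integrals at complex frequencies -/

/-- The Fourier integral of `Φ` at a complex frequency `z`. -/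
def complexFourier (Φ : ℝ → ℂ) (z : ℂ) : ℂ :=
  ∫ w : ℝ, Complex.exp (-2 * Real.pi * Complex.I * w * z) * Φ w

theorem norm_complexFourier_kernel (w : ℝ) (z : ℂ) :
    ‖Complex.exp (-2 * Real.pi * Complex.I * w * z)‖ = Real.exp (2 * Real.pi * w * z.im) := by
  rw [Complex.norm_exp]
  congr 1
  simp [Complex.mul_re, Complex.mul_im]

theorem norm_complexFourier_integrand_le {T : ℝ} {Φ : ℝ → ℂ}
    (hs : ∀ w, T < 2 * Real.pi * |w| → Φ w = 0) (w : ℝ) (z : ℂ) :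
    ‖Complex.exp (-2 * Real.pi * Complex.I * w * z) * Φ w‖
      ≤ Real.exp (T * |z.im|) * ‖Φ w‖ := by
  by_cases h : T < 2 * Real.pi * |w|
  · simp [hs w h]
  · rw [norm_mul, norm_complexFourier_kernel]
    refine mul_le_mul_of_nonneg_right (Real.exp_le_exp.2 ?_) (norm_nonneg _)
    calc 2 * Real.pi * w * z.im ≤ |2 * Real.pi * w * z.im| := le_abs_self _
      _ = 2 * Real.pi * |w| * |z.im| := by
        rw [abs_mul, abs_mul, abs_of_pos (by positivity : 0 < 2 * Real.pi)]
      _ ≤ T * |z.im| := by gcongr; exact not_lt.1 h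

theorem norm_complexFourier_le {T : ℝ} {Φ : ℝ → ℂ} (hΦ : Integrable Φ)
    (hs : ∀ w, T < 2 * Real.pi * |w| → Φ w = 0) (z : ℂ) :
    ‖complexFourier Φ z‖ ≤ (∫ w, ‖Φ w‖) * Real.exp (T * |z.im|) := by
  rw [mul_comm, ← integral_const_mul]
  exact norm_integral_le_of_norm_le (hΦ.norm.const_mul _)
    (Eventually.of_forall fun w => norm_complexFourier_integrand_le hs w z)

theorem integrable_mul_of_support {T : ℝ} {Φ : ℝ → ℂ} (hΦ : Integrable Φ)
    (hs : ∀ w, T < 2 * Real.pi * |w| → Φ w = 0) :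
    Integrable fun w : ℝ => -2 * Real.pi * Complex.I * w * Φ w := by
  refine (hΦ.norm.const_mul |T|).mono' ?_ (Eventually.of_forall fun w => ?_)
  · exact (Continuous.aestronglyMeasurable (by fun_prop)).mul hΦ.1
  · by_cases h : T < 2 * Real.pi * |w|
    · simp [hs w h]
    · rw [norm_mul]
      gcongr
      have : ‖(-2 * Real.pi * Complex.I * w : ℂ)‖ = 2 * Real.pi * |w| := by
        simp [abs_of_pos Real.pi_pos]
      rw [this]
      exact (not_lt.1 h).trans (le_abs_self _)

/-- Differentiation under the integral: the derivative is again a Fourier integral of a function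
with the same support. -/
theorem hasDerivAt_complexFourier {T : ℝ} {Φ : ℝ → ℂ} (hΦ : Integrable Φ)
    (hs : ∀ w, T < 2 * Real.pi * |w| → Φ w = 0) (z : ℂ) :
    HasDerivAt (complexFourier Φ)
      (complexFourier (fun w : ℝ => -2 * Real.pi * Complex.I * w * Φ w) z) z := by
  have hΨ := integrable_mul_of_support hΦ hs
  have hsΨ : ∀ w : ℝ, T < 2 * Real.pi * |w| → -2 * Real.pi * Complex.I * w * Φ w = 0 :=
    fun w hw => by rw [hs w hw, mul_zero]
  have hmeas : ∀ x : ℂ, AEStronglyMeasurable (fun w : ℝ =>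
      Complex.exp (-2 * Real.pi * Complex.I * w * x)) volume := fun x =>
    Continuous.aestronglyMeasurable (by fun_prop)
  refine (hasDerivAt_integral_of_dominated_loc_of_deriv_le
    (F := fun (z : ℂ) (w : ℝ) => Complex.exp (-2 * Real.pi * Complex.I * w * z) * Φ w)
    (F' := fun (z : ℂ) (w : ℝ) => Complex.exp (-2 * Real.pi * Complex.I * w * z)
      * (-2 * Real.pi * Complex.I * w * Φ w))
    (bound := fun w : ℝ => Real.exp (|T| * (|z.im| + 1)) * ‖-2 * Real.pi * Complex.I * w * Φ w‖)
    (Metric.ball_mem_nhds z one_pos)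
    (Eventually.of_forall fun x => (hmeas x).mul hΦ.1) ?_ ((hmeas z).mul hΨ.1)
    (Eventually.of_forall fun w x hx => ?_) (hΨ.norm.const_mul _)
    (Eventually.of_forall fun w x _ => ?_)).2
  · exact (hΦ.norm.const_mul _).mono' ((hmeas z).mul hΦ.1)
      (Eventually.of_forall fun w => norm_complexFourier_integrand_le hs w z)
  · refine (norm_complexFourier_integrand_le hsΨ w x).trans ?_
    gcongr
    · exact le_abs_self T
    · have h1 : |(x - z).im| < 1 :=
        (Complex.abs_im_le_norm _).trans_lt (by simpa [dist_eq_norm] using hx)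
      have h2 := abs_sub_abs_le_abs_sub x.im z.im
      rw [Complex.sub_im] at h1
      linarith
  · have h1 : HasDerivAt (fun x : ℂ => -2 * Real.pi * Complex.I * w * x)
        (-2 * Real.pi * Complex.I * w) x := by
      simpa using (hasDerivAt_id x).const_mul (-2 * Real.pi * Complex.I * w : ℂ)
    convert! (h1.cexp.mul_const (Φ w)) using 1
    ring

theorem complexFourier_ofReal (Φ : ℝ → ℂ) (s : ℝ) : complexFourier Φ s = 𝓕 Φ s := by
  rw [Real.fourier_real_eq_integral_exp_smul]
  refine integral_congr_ae (Eventually.of_forall fun w => ?_)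
  simp only [smul_eq_mul]
  congr 2
  push_cast
  ring

/-- On a horizontal line `complexFourier Φ` is the Fourier transform of a weighted `Φ`, so that it
tends to zero by the Riemann-Lebesgue lemma. -/
theorem tendsto_complexFourier_horizontal (Φ : ℝ → ℂ) (y : ℝ) :
    Tendsto (fun s : ℝ => complexFourier Φ (s + y * Complex.I)) (cocompact ℝ) (𝓝 0) := by
  refine (Real.zero_at_infty_fourier
    (fun w : ℝ => (Real.exp (2 * Real.pi * w * y) : ℂ) * Φ w)).congr fun s => ?_
  rw [← complexFourier_ofReal]
  refine integral_congr_ae (Eventually.of_forall fun w => ?_)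
  simp only
  rw [← mul_assoc, Complex.ofReal_exp, ← Complex.exp_add]
  congr 2
  push_cast
  linear_combination (2 * Real.pi * w * y : ℂ) * Complex.I_sq

/-- The decay along horizontal lines is uniform on horizontal strips of bounded width, since
`complexFourier Φ` has bounded derivative there. -/
theorem tendstoUniformlyOn_complexFourier {T : ℝ} {Φ : ℝ → ℂ} (hΦ : Integrable Φ)
    (hs : ∀ w, T < 2 * Real.pi * |w| → Φ w = 0) (a b : ℝ) :
    TendstoUniformlyOn (fun s y : ℝ => complexFourier Φ (s + y * Complex.I)) (fun _ => 0)
      (cocompact ℝ) (Icc a b) := by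
  have hΨ := integrable_mul_of_support hΦ hs
  have hsΨ : ∀ w : ℝ, T < 2 * Real.pi * |w| → -2 * Real.pi * Complex.I * w * Φ w = 0 :=
    fun w hw => by rw [hs w hw, mul_zero]
  set M : ℝ := (∫ w : ℝ, ‖-2 * Real.pi * Complex.I * w * Φ w‖)
    * Real.exp (|T| * (|a| + |b|)) with hM
  have hM0 : 0 ≤ M := by positivity
  have hlip : ∀ s y y' : ℝ, y ∈ Icc a b → y' ∈ Icc a b →
      ‖complexFourier Φ (s + y * Complex.I) - complexFourier Φ (s + y' * Complex.I)‖
        ≤ M * |y - y'| := by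
    intro s y y' hy hy'
    have := (convex_Icc a b).norm_image_sub_le_of_norm_hasDerivWithin_le
      (f := fun y : ℝ => complexFourier Φ (s + y * Complex.I))
      (f' := fun y : ℝ => complexFourier (fun w : ℝ => -2 * Real.pi * Complex.I * w * Φ w)
        (s + y * Complex.I) * Complex.I) (C := M) (fun x _ => ?_) (fun x hx => ?_) hy' hy
    · simpa using this
    · have h1 : HasDerivAt (fun y : ℝ => (s + y * Complex.I : ℂ)) Complex.I x := by
        simpa using ((Complex.ofRealCLM.hasDerivAt (x := x)).mul_const Complex.I).const_add (s : ℂ)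
      exact ((hasDerivAt_complexFourier hΦ hs _).comp x h1).hasDerivWithinAt
    · rw [norm_mul, Complex.norm_I, mul_one]
      refine (norm_complexFourier_le hΨ hsΨ _).trans ?_
      rw [hM]
      gcongr
      · exact le_abs_self T
      · simp only [Complex.add_im, Complex.ofReal_im, Complex.mul_im, Complex.ofReal_re,
          Complex.I_im, mul_one, Complex.I_re, mul_zero, add_zero, zero_add]
        exact (abs_le_max_abs_abs hx.1 hx.2).trans
          (max_le_add_of_nonneg (abs_nonneg a) (abs_nonneg b))
  rw [← tendstoLocallyUniformlyOn_iff_tendstoUniformlyOn_of_compact isCompact_Icc,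
    Metric.tendstoLocallyUniformlyOn_iff]
  intro ε hε y₀ hy₀
  refine ⟨Icc a b ∩ Metric.ball y₀ (ε / (2 * (M + 1))),
    inter_mem self_mem_nhdsWithin
      (mem_nhdsWithin_of_mem_nhds (Metric.ball_mem_nhds _ (by positivity))), ?_⟩
  filter_upwards [(tendsto_complexFourier_horizontal Φ y₀).eventually
    (Metric.ball_mem_nhds _ (half_pos hε))] with s hs' y hy
  rw [dist_zero_left]
  rw [dist_zero_right] at hs'
  have h1 := hlip s y y₀ hy.1 hy₀
  have h2 : M * |y - y₀| ≤ ε / 2 := by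
    have h3 : |y - y₀| < ε / (2 * (M + 1)) := by simpa [Real.dist_eq] using hy.2
    calc M * |y - y₀| ≤ (M + 1) * (ε / (2 * (M + 1))) := by gcongr; linarith
      _ = ε / 2 := by field_simp
  have h4 := norm_add_le
    (complexFourier Φ (s + y * Complex.I) - complexFourier Φ (s + y₀ * Complex.I))
    (complexFourier Φ (s + y₀ * Complex.I))
  rw [sub_add_cancel] at h4
  linarith

/-! ### Functions on the Riemann surface of the logarithm from entire functions -/

/-- The branches on the slit plane of the function on the Riemann surface of the logarithm that
reads `H` in the logarithmic coordinate. The principal logarithm of `-z` is holomorphic off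
`[0, ∞)` and has imaginary part `arg z - π` for `arg z ∈ (0, 2π)`. -/
def logBranch (H : ℂ → ℂ) (k : ℤ) (z : ℂ) : ℂ :=
  H (Complex.log (-z) + (2 * Real.pi * k + Real.pi : ℝ) * Complex.I)

theorem neg_mem_slitPlane_of_mem_Omega {z : ℂ} (hz : z ∈ Omega) : -z ∈ Complex.slitPlane := by
  rw [Complex.mem_slitPlane_iff, Complex.neg_re, Complex.neg_im]
  by_contra! h
  exact hz ⟨by linarith [h.1], by simpa using h.2⟩

theorem log_polar {r θ : ℝ} (hr : 0 < r) (h1 : -Real.pi < θ) (h2 : θ ≤ Real.pi) :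
    Complex.log (r * Complex.exp (θ * Complex.I)) = Real.log r + θ * Complex.I := by
  rw [Complex.log_ofReal_mul hr (Complex.exp_ne_zero _), Complex.log_exp] <;> simpa

theorem logBranch_polar (H : ℂ → ℂ) (k : ℤ) {r θ : ℝ} (hr : 0 < r) (h1 : 0 < θ)
    (h2 : θ < 2 * Real.pi) :
    logBranch H k (r * Complex.exp (θ * Complex.I))
      = H (Real.log r + (2 * Real.pi * k + θ : ℝ) * Complex.I) := by
  have e : -(r * Complex.exp (θ * Complex.I) : ℂ)
      = r * Complex.exp ((θ - Real.pi : ℝ) * Complex.I) := by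
    push_cast
    rw [sub_mul, Complex.exp_sub, Complex.exp_pi_mul_I]
    ring
  rw [logBranch, e, log_polar hr (by linarith) (by linarith)]
  congr 1
  push_cast
  ring

theorem logBranch_of_im_pos (H : ℂ → ℂ) (k : ℤ) {z : ℂ} (hz : 0 < z.im) :
    logBranch H k z = H (Complex.log z + (2 * Real.pi * k : ℝ) * Complex.I) := by
  rw [logBranch, Complex.log, Complex.log, norm_neg, Complex.arg_neg_eq_arg_sub_pi_of_im_pos hz]
  congr 1
  push_cast
  ring

theorem logBranch_of_im_neg (H : ℂ → ℂ) (k : ℤ) {z : ℂ} (hz : z.im < 0) :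
    logBranch H k z = H (Complex.log z + (2 * Real.pi * (k + 1 : ℤ) : ℝ) * Complex.I) := by
  rw [logBranch, Complex.log, Complex.log, norm_neg, Complex.arg_neg_eq_arg_add_pi_of_im_neg hz]
  congr 1
  push_cast
  ring

/-- The boundary value at argument `2πk` of the function that reads `H` in the logarithmic
coordinate. -/
def logBoundary (H : ℂ → ℂ) (k : ℤ) (x : ℝ) : ℂ :=
  H (Real.log x + (2 * Real.pi * k : ℝ) * Complex.I)

theorem polarValue_logBranch (H : ℂ → ℂ) (k : ℤ) {r θ : ℝ} (hr : 0 < r)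
    (hθ : θ ∈ Icc 0 (2 * Real.pi)) :
    polarValue (logBranch H k) (logBoundary H k) (logBoundary H (k + 1)) r θ
      = H (Real.log r + (2 * Real.pi * k + θ : ℝ) * Complex.I) := by
  unfold polarValue
  split_ifs with h0 h1
  · rw [h0, logBoundary, add_zero]
  · rw [h1, logBoundary]
    congr 3
    push_cast
    ring
  · exact logBranch_polar H k hr (lt_of_le_of_ne hθ.1 (Ne.symm h0)) (lt_of_le_of_ne hθ.2 h1)

theorem isAnalytic_comp_log {H : ℂ → ℂ} (hH : Differentiable ℂ H) :
    LogSurface.IsAnalytic fun p => H (Real.log p.1.1 + p.1.2 * Complex.I) := by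
  intro p
  have hp : p.proj ≠ 0 :=
    mul_ne_zero (by exact_mod_cast p.2.ne') (Complex.exp_ne_zero _)
  -- Near `p` the logarithmic coordinate is recovered from the quotient of the covering projections.
  refine ⟨fun z => H (Complex.log (z / p.proj) + (Real.log p.1.1 + p.1.2 * Complex.I)), ?_, ?_⟩
  · have h1 : AnalyticAt ℂ (fun z => Complex.log (z / p.proj)
        + (Real.log p.1.1 + p.1.2 * Complex.I)) p.proj :=
      (((analyticAt_id.div analyticAt_const hp)).clog (by simp [hp])).add analyticAt_const
    exact AnalyticAt.comp (hH.analyticAt _) h1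
  · have hc : Continuous fun q : LogSurface => q.1.2 - p.1.2 := by fun_prop
    have h1 : ∀ᶠ q : LogSurface in 𝓝 p, |q.1.2 - p.1.2| < Real.pi := by
      refine hc.abs.continuousAt.eventually_lt continuousAt_const ?_
      simpa using Real.pi_pos
    filter_upwards [h1] with q hq
    have hq' := abs_lt.1 hq
    have e : q.proj / p.proj
        = (q.1.1 / p.1.1 : ℝ) * Complex.exp ((q.1.2 - p.1.2 : ℝ) * Complex.I) := by
      rw [LogSurface.proj, LogSurface.proj, Complex.ofReal_div, Complex.ofReal_sub, sub_mul,
        Complex.exp_sub]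
      exact mul_div_mul_comm _ _ _ _
    rw [e, log_polar (div_pos q.2 p.2) hq'.1 hq'.2.le, Real.log_div q.2.ne' p.2.ne']
    congr 1
    push_cast
    ring

/-- An entire function of exponential type that decays on horizontal strips gives, read in the
logarithmic coordinate, an extension with all the properties of the Mellin-Bernstein space. -/
theorem isBernsteinExtension_of_entire {c T : ℝ} {f : ℝ → ℂ} {H : ℂ → ℂ}
    (hH : Differentiable ℂ H)
    (hf : ∀ x : ℝ, 0 < x → H (Real.log x) = ((x ^ c : ℝ) : ℂ) * f x)
    (hg : ∃ C : ℝ, 0 < C ∧ ∀ z, ‖H z‖ ≤ C * Real.exp (T * |z.im|))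
    (hd : ∀ a b : ℝ, TendstoUniformlyOn (fun s y : ℝ => H (s + y * Complex.I)) (fun _ => 0)
      (cocompact ℝ) (Icc a b)) :
    IsBernsteinExtension c T f (fun p => H (Real.log p.1.1 + p.1.2 * Complex.I))
      (logBranch H) (logBoundary H) (fun k => logBoundary H (k + 1)) := by
  have hdecay : ∀ (k : ℤ) (l : Filter ℝ), Tendsto Real.log l (cocompact ℝ) →
      (∀ᶠ r in l, 0 < r) →
      TendstoUniformlyOn (fun r θ : ℝ => polarValue (logBranch H k) (logBoundary H k)
        (logBoundary H (k + 1)) r θ) (fun _ => 0) l (Icc 0 (2 * Real.pi)) := by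
    intro k l hl hpos
    have h := hd (2 * Real.pi * k) (2 * Real.pi * k + 2 * Real.pi)
    rw [Metric.tendstoUniformlyOn_iff] at h ⊢
    intro ε hε
    filter_upwards [hl.eventually (h ε hε), hpos] with r hr hr0 θ hθ
    rw [polarValue_logBranch H k hr0 hθ]
    exact hr _ ⟨by linarith [hθ.1], by linarith [hθ.2]⟩
  have hright : ∀ x : ℝ, 0 < x → (x : ℂ) ∈ Complex.slitPlane := fun x hx =>
    Complex.ofReal_mem_slitPlane.2 hx
  have hcont : ∀ (a : ℂ) (z : ℂ), z ∈ Complex.slitPlane →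
      ContinuousAt (fun z => H (Complex.log z + a)) z := fun a z hz =>
    ContinuousAt.comp (f := fun z => Complex.log z + a) hH.continuous.continuousAt
      ((continuousAt_clog hz).add continuousAt_const)
  refine
    { analytic := isAnalytic_comp_log hH
      extends_g := fun x hx => ?_
      branch := fun k r θ hr h1 h2 => logBranch_polar H k hr h1 h2
      branch_analytic := fun k z hz => ?_
      tendsto_upper := fun k x hx => ?_
      tendsto_lower := fun k x hx => ?_
      lower_eq_upper := fun k x _ => rfl
      upper_zero := fun x hx => ?_
      glue_analytic := fun k x δ _ hδx => ?_
      growth := ?_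
      decay_zero := fun k => hdecay k _ ?_ self_mem_nhdsWithin
      decay_top := fun k => hdecay k _ ?_ (eventually_gt_atTop 0) }
  · rw [← hf x hx]
    simp [LogSurface.point]
  · have h1 : AnalyticAt ℂ (fun z => Complex.log (-z)
        + (2 * Real.pi * k + Real.pi : ℝ) * Complex.I) z :=
      (analyticAt_id.neg.clog (neg_mem_slitPlane_of_mem_Omega hz)).add analyticAt_const
    exact AnalyticAt.comp (hH.analyticAt _) h1
  · have hl : Tendsto (fun ε : ℝ => (x : ℂ) + (ε : ℂ) * Complex.I) (𝓝[>] 0) (𝓝 x) := by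
      have : Continuous fun ε : ℝ => (x : ℂ) + (ε : ℂ) * Complex.I := by fun_prop
      simpa using (this.tendsto 0).mono_left nhdsWithin_le_nhds
    have := (hcont ((2 * Real.pi * k : ℝ) * Complex.I) x (hright x hx)).tendsto.comp hl
    rw [← Complex.ofReal_log hx.le] at this
    refine this.congr' ?_
    filter_upwards [self_mem_nhdsWithin] with ε hε
    exact (logBranch_of_im_pos H k (by simpa using hε)).symm
  · have hl : Tendsto (fun ε : ℝ => (x : ℂ) - (ε : ℂ) * Complex.I) (𝓝[>] 0) (𝓝 x) := by
      have : Continuous fun ε : ℝ => (x : ℂ) - (ε : ℂ) * Complex.I := by fun_prop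
      simpa using (this.tendsto 0).mono_left nhdsWithin_le_nhds
    have := (hcont ((2 * Real.pi * (k + 1 : ℤ) : ℝ) * Complex.I) x (hright x hx)).tendsto.comp hl
    rw [← Complex.ofReal_log hx.le] at this
    refine this.congr' ?_
    filter_upwards [self_mem_nhdsWithin] with ε hε
    exact (logBranch_of_im_neg H k (by simpa using hε)).symm
  · rw [← hf x hx, logBoundary]
    simp
  · -- All three pieces of the glued function come from the principal logarithm of `z`.
    have hpos : ∀ z ∈ Metric.ball (x : ℂ) δ, 0 < z.re := by
      intro z hz
      have h1 := (Complex.abs_re_le_norm (z - x)).trans_lt (by simpa [dist_eq_norm] using hz)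
      rw [Complex.sub_re, Complex.ofReal_re] at h1
      linarith [(abs_lt.1 h1).1]
    have hd1 : DifferentiableOn ℂ
        (fun z => H (Complex.log z + (2 * Real.pi * (k + 1 : ℤ) : ℝ) * Complex.I))
        (Metric.ball (x : ℂ) δ) := fun z hz =>
      (DifferentiableAt.comp z (hH _) ((Complex.differentiableAt_log
        (Complex.mem_slitPlane_iff.2 (Or.inl (hpos z hz)))).add_const _)).differentiableWithinAt
    refine (hd1.analyticOnNhd Metric.isOpen_ball).congr Metric.isOpen_ball fun z hz => ?_
    simp only [glue]
    split_ifs with h1 h2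
    · exact (logBranch_of_im_neg H k h1).symm
    · have e : z = (z.re : ℂ) := Complex.ext rfl (by simpa using h2)
      rw [logBoundary, Complex.ofReal_log (hpos z hz).le, ← e]
    · exact (logBranch_of_im_pos H (k + 1)
        (lt_of_le_of_ne (not_lt.1 h1) (Ne.symm h2))).symm
  · obtain ⟨C, hC, hb⟩ := hg
    refine ⟨C, hC, fun k θ hθ r hr => ?_⟩
    rw [polarValue_logBranch H k hr hθ]
    simpa using hb (Real.log r + (2 * Real.pi * k + θ : ℝ) * Complex.I)
  · exact Real.tendsto_log_nhdsGT_zero.mono_right atBot_le_cocompact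
  · exact Real.tendsto_log_atTop.mono_right atTop_le_cocompact

/-! ### Entire functions from the Riemann surface of the logarithm; shifting contours -/

/-- A function on the Riemann surface of the logarithm read in the logarithmic coordinate. -/
def logPlane (G : LogSurface → ℂ) (z : ℂ) : ℂ :=
  G (LogSurface.point (Real.exp z.re) z.im (Real.exp_pos _))

theorem differentiable_logPlane {G : LogSurface → ℂ} (hG : LogSurface.IsAnalytic G) :
    Differentiable ℂ (logPlane G) := by
  intro z
  have hproj : ∀ z : ℂ,
      (LogSurface.point (Real.exp z.re) z.im (Real.exp_pos _)).proj = Complex.exp z := by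
    intro z
    simp only [LogSurface.proj, LogSurface.point]
    rw [Complex.ofReal_exp, ← Complex.exp_add, Complex.re_add_im]
  have hc : Continuous fun z : ℂ => LogSurface.point (Real.exp z.re) z.im (Real.exp_pos _) :=
    ((Real.continuous_exp.comp Complex.continuous_re).prodMk Complex.continuous_im).subtype_mk _
  obtain ⟨ψ, h1, h2⟩ := hG (LogSurface.point (Real.exp z.re) z.im (Real.exp_pos _))
  rw [hproj] at h1
  have h3 : logPlane G =ᶠ[𝓝 z] fun z => ψ (Complex.exp z) := by
    filter_upwards [hc.continuousAt.eventually h2] with y hy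
    rw [← hproj]
    exact hy
  exact (DifferentiableAt.comp z h1.differentiableAt
    Complex.differentiableAt_exp).congr_of_eventuallyEq h3

/-- The growth condition on the branches bounds the extension off the arguments in `2πℤ`, and by
continuity everywhere. -/
theorem IsBernsteinExtension.norm_logPlane_le {c T : ℝ} {f : ℝ → ℂ} {G : LogSurface → ℂ}
    {g : ℤ → ℂ → ℂ} {gp gm : ℤ → ℝ → ℂ} (h : IsBernsteinExtension c T f G g gp gm) :
    ∃ C : ℝ, 0 < C ∧ ∀ z, ‖logPlane G z‖ ≤ C * Real.exp (T * |z.im|) := by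
  obtain ⟨C, hC, hb⟩ := h.growth
  refine ⟨C, hC, fun z => ?_⟩
  have hpi : 0 < 2 * Real.pi := by positivity
  obtain ⟨k, hk, -⟩ := existsUnique_zsmul_near_of_pos hpi z.im
  simp only [zsmul_eq_mul, Int.cast_add, Int.cast_one] at hk
  have hL : Tendsto (fun ε : ℝ => ‖logPlane G (z + ε * Complex.I)‖) (𝓝[>] 0)
      (𝓝 ‖logPlane G z‖) := by
    have hc : Continuous fun ε : ℝ => ‖logPlane G (z + ε * Complex.I)‖ :=
      ((differentiable_logPlane h.analytic).continuous.comp (by fun_prop)).norm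
    simpa using (hc.tendsto 0).mono_left nhdsWithin_le_nhds
  have hR : Tendsto (fun ε : ℝ => C * Real.exp (T * |z.im + ε|)) (𝓝[>] 0)
      (𝓝 (C * Real.exp (T * |z.im|))) := by
    have hc : Continuous fun ε : ℝ => C * Real.exp (T * |z.im + ε|) := by fun_prop
    simpa using (hc.tendsto 0).mono_left nhdsWithin_le_nhds
  refine le_of_tendsto_of_tendsto hL hR ?_
  have hlt : (0 : ℝ) < (k + 1) * (2 * Real.pi) - z.im := by linarith [hk.2]
  filter_upwards [Ioo_mem_nhdsGT hlt] with ε hε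
  set θ : ℝ := z.im + ε - 2 * Real.pi * k with hθ
  have h0 : 0 < θ := by linarith [hk.1, hε.1]
  have h1 : θ < 2 * Real.pi := by linarith [hε.2]
  have h2 := hb k θ ⟨h0.le, h1.le⟩ (Real.exp z.re) (Real.exp_pos _)
  have e : 2 * Real.pi * k + θ = z.im + ε := by rw [hθ]; ring
  rw [polarValue, if_neg h0.ne', if_neg h1.ne, h.branch k _ _ (Real.exp_pos _) h0 h1, e] at h2
  simpa [logPlane] using h2

theorem IsBernsteinExtension.logPlane_ofReal {c T : ℝ} {f : ℝ → ℂ} {G : LogSurface → ℂ}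
    {g : ℤ → ℂ → ℂ} {gp gm : ℤ → ℝ → ℂ} (h : IsBernsteinExtension c T f G g gp gm) (s : ℝ) :
    logPlane G s = logPullback c f s := by
  have := h.extends_g (Real.exp s) (Real.exp_pos s)
  rw [← Real.exp_mul, mul_comm s c] at this
  rw [logPullback, ← this]
  rfl

/-- If `‖K(x + iy)‖` is dominated by a Gaussian in `x` on the strip between the real axis and the
line `Im = b`, the integrals of `K` along the two lines agree. -/
theorem integral_eq_integral_add_mul_I {K : ℂ → ℂ} (hK : Differentiable ℂ K) {b ε M : ℝ}
    (hε : 0 < ε) (hM : ∀ x y : ℝ, |y| ≤ |b| → ‖K (x + y * Complex.I)‖ ≤ M * Real.exp (-ε * x ^ 2)) :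
    ∫ x : ℝ, K x = ∫ x : ℝ, K (x + b * Complex.I) := by
  have hint : ∀ y : ℝ, |y| ≤ |b| → Integrable fun x : ℝ => K (x + y * Complex.I) := fun y hy =>
    ((integrable_exp_neg_mul_sq hε).const_mul M).mono'
      (hK.continuous.comp (by fun_prop)).aestronglyMeasurable
      (Eventually.of_forall fun x => hM x y hy)
  have hrect : ∀ R : ℝ, (∫ x in (-R)..R, K (x + (0 : ℝ) * Complex.I))
      - (∫ x in (-R)..R, K (x + b * Complex.I))
      = Complex.I * (∫ y in (0 : ℝ)..b, K ((-R : ℝ) + y * Complex.I))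
        - Complex.I * ∫ y in (0 : ℝ)..b, K (R + y * Complex.I) := by
    intro R
    have := Complex.integral_boundary_rect_eq_zero_of_differentiableOn K
      ((-R : ℝ) : ℂ) (R + b * Complex.I) hK.differentiableOn
    simp only [Complex.ofReal_re, Complex.ofReal_im, Complex.add_re, Complex.mul_re, Complex.I_re,
      mul_zero, Complex.I_im, mul_one, sub_self, add_zero, Complex.add_im, Complex.mul_im,
      zero_add, smul_eq_mul] at this
    linear_combination this
  have hvert : ∀ R : ℝ, ∀ u : ℝ, |u| = |R| →
      ‖∫ y in (0 : ℝ)..b, K (u + y * Complex.I)‖ ≤ M * Real.exp (-ε * R ^ 2) * |b| := by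
    intro R u hu
    have := intervalIntegral.norm_integral_le_of_norm_le_const (a := 0) (b := b)
      (f := fun y : ℝ => K (u + y * Complex.I)) (C := M * Real.exp (-ε * R ^ 2)) fun y hy => ?_
    · simpa using this
    · rw [← sq_abs R, ← hu, sq_abs]
      refine hM u y ?_
      rcases le_total 0 b with h | h
      · rw [uIoc_of_le h] at hy
        exact abs_le_abs_of_nonneg hy.1.le hy.2
      · rw [uIoc_of_ge h] at hy
        exact abs_le_abs_of_nonpos hy.2 hy.1.le
  have hg : Tendsto (fun R : ℝ => M * Real.exp (-ε * R ^ 2) * |b|) atTop (𝓝 0) := by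
    have h1 : Tendsto (fun R : ℝ => -ε * R ^ 2) atTop atBot :=
      (tendsto_pow_atTop two_ne_zero).const_mul_atTop_of_neg (neg_lt_zero.2 hε)
    simpa using ((Real.tendsto_exp_atBot.comp h1).const_mul M).mul_const |b|
  have hside : ∀ u : ℝ → ℝ, (∀ R, |u R| = |R|) →
      Tendsto (fun R : ℝ => Complex.I * ∫ y in (0 : ℝ)..b, K (u R + y * Complex.I)) atTop
        (𝓝 0) := by
    intro u hu
    have := squeeze_zero_norm (fun R => hvert R (u R) (hu R)) hg
    simpa using this.const_mul Complex.I
  have hz : Tendsto (fun R : ℝ => (∫ x in (-R)..R, K (x + (0 : ℝ) * Complex.I))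
      - (∫ x in (-R)..R, K (x + b * Complex.I))) atTop (𝓝 0) := by
    simp only [hrect]
    simpa using (hside (fun R => -R) (fun R => abs_neg R)).sub (hside (fun R => R) fun _ => rfl)
  have hlim := (intervalIntegral_tendsto_integral (hint 0 (by simp))
    tendsto_neg_atTop_atBot tendsto_id).sub
    (intervalIntegral_tendsto_integral (hint b le_rfl) tendsto_neg_atTop_atBot tendsto_id)
  have := tendsto_nhds_unique hlim hz
  simpa [sub_eq_zero] using this

/-! ### The Paley-Wiener theorem -/

/-- Shifting the contour to `Im = b` bounds the inverse Fourier integral of a function of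
exponential type multiplied by the Gaussian `e^{-εs²}`. -/
theorem norm_fourierInv_gaussian_mul_le {H : ℂ → ℂ} (hH : Differentiable ℂ H) {C T : ℝ}
    (hT : 0 ≤ T) (hC : 0 ≤ C) (hb : ∀ z, ‖H z‖ ≤ C * Real.exp (T * |z.im|)) {ε : ℝ} (hε : 0 < ε)
    (w b : ℝ) :
    ‖𝓕⁻ (fun s : ℝ => Complex.exp (-ε * s ^ 2) * H s) w‖
      ≤ C * Real.exp (T * |b| - 2 * Real.pi * w * b + ε * b ^ 2) * √(Real.pi / ε) := by
  set K : ℂ → ℂ := fun z => Complex.exp (2 * Real.pi * w * z * Complex.I)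
    * (Complex.exp (-ε * z ^ 2) * H z) with hKdef
  have hK : Differentiable ℂ K := by fun_prop
  have hn : ∀ x y : ℝ, ‖K (x + y * Complex.I)‖
      ≤ C * Real.exp (T * |y| - 2 * Real.pi * w * y + ε * y ^ 2) * Real.exp (-ε * x ^ 2) := by
    intro x y
    have h1 := hb (x + y * Complex.I)
    have e1 : ‖Complex.exp (2 * Real.pi * w * (x + y * Complex.I) * Complex.I)‖
        = Real.exp (-(2 * Real.pi * w * y)) := by
      rw [Complex.norm_exp]
      congr 1
      simp [Complex.mul_re, Complex.mul_im]
    have e2 : ‖Complex.exp (-ε * (x + y * Complex.I) ^ 2)‖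
        = Real.exp (ε * y ^ 2) * Real.exp (-ε * x ^ 2) := by
      rw [Complex.norm_exp, ← Real.exp_add]
      congr 1
      simp [sq, Complex.mul_re, Complex.mul_im]
      ring
    simp only [Complex.add_im, Complex.ofReal_im, Complex.mul_im, Complex.ofReal_re,
      Complex.I_im, mul_one, Complex.I_re, mul_zero, add_zero, zero_add] at h1
    rw [hKdef]
    simp only
    rw [norm_mul, norm_mul, e1, e2]
    calc _ ≤ Real.exp (-(2 * Real.pi * w * y)) * (Real.exp (ε * y ^ 2) * Real.exp (-ε * x ^ 2)
          * (C * Real.exp (T * |y|))) := by gcongr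
      _ = C * (Real.exp (T * |y|) * Real.exp (-(2 * Real.pi * w * y)) * Real.exp (ε * y ^ 2))
          * Real.exp (-ε * x ^ 2) := by ring
      _ = _ := by rw [← Real.exp_add, ← Real.exp_add, ← sub_eq_add_neg]
  have h1 : 𝓕⁻ (fun s : ℝ => Complex.exp (-ε * s ^ 2) * H s) w = ∫ x : ℝ, K x := by
    rw [Real.fourierInv_eq']
    refine integral_congr_ae (Eventually.of_forall fun s => ?_)
    simp only [hKdef, smul_eq_mul, RCLike.inner_apply, conj_trivial]
    push_cast
    ring_nf
  rw [h1, integral_eq_integral_add_mul_I hK (b := b)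
    (M := C * Real.exp (T * |b| + 2 * Real.pi * |w| * |b| + ε * b ^ 2)) hε fun x y hy => ?_]
  · refine (norm_integral_le_of_norm_le ((integrable_exp_neg_mul_sq hε).const_mul _)
      (Eventually.of_forall fun x => hn x b)).trans (le_of_eq ?_)
    rw [integral_const_mul, integral_gaussian]
  · refine (hn x y).trans ?_
    have h2 : -(2 * Real.pi * w * y) ≤ 2 * Real.pi * |w| * |b| := by
      calc -(2 * Real.pi * w * y) ≤ |2 * Real.pi * w * y| := neg_le_abs _
        _ = 2 * Real.pi * |w| * |y| := by
          rw [abs_mul, abs_mul, abs_of_pos (by positivity : 0 < 2 * Real.pi)]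
        _ ≤ _ := by gcongr
    have h3 : y ^ 2 ≤ b ^ 2 := sq_le_sq.2 hy
    have h4 : T * |y| ≤ T * |b| := by gcongr
    have h5 : ε * y ^ 2 ≤ ε * b ^ 2 := by gcongr
    gcongr C * Real.exp ?_ * Real.exp (-ε * x ^ 2)
    linarith

/-- The Paley-Wiener theorem on the support of the transform: for an entire function of exponential
type `T`, bounded on horizontal lines by `C e^{T |Im z|}` and square-integrable on the real axis,
the inverse Fourier transform vanishes for `2π|w| > T`. -/
theorem fourierInv_ae_eq_zero_of_exponential_type {H : ℂ → ℂ} (hH : Differentiable ℂ H) {C T : ℝ}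
    (hT : 0 ≤ T) (hC : 0 ≤ C) (hb : ∀ z, ‖H z‖ ≤ C * Real.exp (T * |z.im|)) {h : ℝ → ℂ}
    (hh : MemLp h 2) (hHh : ∀ s : ℝ, H s = h s) :
    ∀ᵐ w : ℝ, T < 2 * Real.pi * |w| →
      (𝓕⁻ (hh.toLp h) : Lp ℂ 2 (volume : Measure ℝ)) w = 0 := by
  -- The Gaussian of parameter `1 / (n + 1) ^ 2` stays bounded on the lines `Im z = ± (n + 1)`.
  let ε : ℕ → ℝ := fun n => 1 / ((n : ℝ) + 1) ^ 2
  have hε : ∀ n, 0 < ε n := fun n => by positivity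
  let m : ℕ → ℝ → ℂ := fun n s => Complex.exp (-ε n * s ^ 2)
  have hmc : ∀ n, Continuous (m n) := fun n => by fun_prop
  have hnorm : ∀ n s, ‖m n s‖ = Real.exp (-ε n * s ^ 2) := by
    intro n s
    have : (-ε n * s ^ 2 : ℂ) = ((-ε n * s ^ 2 : ℝ) : ℂ) := by push_cast; ring
    simp only [m]
    rw [this, Complex.norm_exp_ofReal]
  have hmb : ∀ n s, ‖m n s‖ ≤ 1 := fun n s => by
    rw [hnorm, Real.exp_le_one_iff]
    have := mul_nonneg (hε n).le (sq_nonneg s)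
    linarith
  have hεlim : Tendsto ε atTop (𝓝 0) := by
    have := (tendsto_one_div_add_atTop_nhds_zero_nat (𝕜 := ℝ)).pow 2
    simpa [ε] using this
  have hmlim : ∀ s, Tendsto (fun n => m n s) atTop (𝓝 1) := by
    intro s
    have hc : Continuous fun e : ℝ => Complex.exp (-e * s ^ 2) := by fun_prop
    simpa [m, Function.comp_def] using (hc.tendsto 0).comp hεlim
  have hhc : Continuous h := by
    have : h = fun s : ℝ => H s := funext fun s => (hHh s).symm
    rw [this]
    exact hH.continuous.comp Complex.continuous_ofReal
  have h2 : ∀ n, MemLp (fun s => m n s * h s) 2 := fun n =>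
    hh.of_le ((hmc n).mul hhc).aestronglyMeasurable (Eventually.of_forall fun s => by
      rw [norm_mul]; exact mul_le_of_le_one_left (norm_nonneg _) (hmb n s))
  have h1 : ∀ n, Integrable fun s => m n s * h s := fun n =>
    ((integrable_exp_neg_mul_sq (hε n)).mul_const C).mono'
      ((hmc n).mul hhc).aestronglyMeasurable (Eventually.of_forall fun s => by
        rw [norm_mul, hnorm, ← hHh]
        gcongr
        simpa using hb s)
  have hconv := tendsto_eLpNorm_fourierInv hh h1 h2
    (tendsto_eLpNorm_sub_mul hh (fun n => (hmc n).measurable) hmb hmlim)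
  have hmeas : TendstoInMeasure volume (fun n => 𝓕⁻ fun s => m n s * h s) atTop
      (𝓕⁻ (hh.toLp h) : Lp ℂ 2 (volume : Measure ℝ)) := by
    refine tendstoInMeasure_of_tendsto_eLpNorm (p := 2) (by norm_num)
      (fun n => (continuous_fourierInv (h1 n)).aestronglyMeasurable) (Lp.aestronglyMeasurable _) ?_
    refine hconv.congr fun n => ?_
    rw [eLpNorm_sub_comm]
    rfl
  obtain ⟨ns, hns, hae⟩ := hmeas.exists_seq_tendsto_ae
  filter_upwards [hae] with w hw hTw
  refine tendsto_nhds_unique hw (Tendsto.comp (g := fun n => 𝓕⁻ (fun s => m n s * h s) w) ?_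
    hns.tendsto_atTop)
  set δ : ℝ := 2 * Real.pi * |w| - T with hδ
  have hδ0 : 0 < δ := sub_pos.2 hTw
  have hbound : ∀ n : ℕ, ‖𝓕⁻ (fun s => m n s * h s) w‖
      ≤ C * Real.exp 1 * √Real.pi * (((n + 1 : ℕ) : ℝ) ^ 1 * Real.exp (-δ * (n + 1 : ℕ))) := by
    intro n
    -- The sign of the shift makes the factor `e^{-2πwb}` decay.
    obtain ⟨b, hb1, hb2⟩ : ∃ b : ℝ, |b| = n + 1 ∧ w * b = |w| * (n + 1) := by
      have hn : (0 : ℝ) ≤ n + 1 := by positivity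
      rcases le_total 0 w with h | h
      · exact ⟨n + 1, abs_of_nonneg hn, by rw [abs_of_nonneg h]⟩
      · exact ⟨-(n + 1), by rw [abs_neg, abs_of_nonneg hn], by rw [abs_of_nonpos h]; ring⟩
    have := norm_fourierInv_gaussian_mul_le hH hT hC hb (hε n) w b
    have e1 : (fun s : ℝ => Complex.exp (-(ε n : ℂ) * s ^ 2) * H s) = fun s => m n s * h s :=
      funext fun s => by simp only [m, hHh]
    have hn : (0 : ℝ) < n + 1 := by positivity
    have e2 : √(Real.pi / ε n) = √Real.pi * (n + 1) := by
      simp only [ε]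
      rw [div_div_eq_mul_div, div_one, Real.sqrt_mul Real.pi_pos.le, Real.sqrt_sq hn.le]
    have e3 : T * |b| - 2 * Real.pi * w * b + ε n * b ^ 2 = 1 + -δ * (n + 1 : ℕ) := by
      rw [← sq_abs b, hb1, mul_assoc _ w b, hb2, hδ]
      simp only [ε]
      push_cast
      field_simp
      ring
    rw [e1, e2, e3, Real.exp_add] at this
    refine this.trans (le_of_eq ?_)
    push_cast
    ring
  refine squeeze_zero_norm hbound ?_
  have hlim : Tendsto (fun x : ℝ => x ^ 1 * Real.exp (-δ * x)) atTop (𝓝 0) := by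
    simpa using tendsto_rpow_mul_exp_neg_mul_atTop_nhds_zero 1 δ hδ0
  have := ((hlim.comp tendsto_natCast_atTop_atTop).comp (tendsto_add_atTop_nat 1)).const_mul
    (C * Real.exp 1 * √Real.pi)
  simpa using this

/-- `L²`-Mellin transforms that vanish for `|t| > T` come from entire functions: a bandlimited `f`
satisfies `e^{cs} f(e^s) = ∫ e^{-2πiws} Φ(w) dw` with `Φ` integrable and supported in
`2π|w| ≤ T`. -/
theorem exists_complexFourier_of_bandlimited {c T : ℝ} {f : ℝ → ℂ} (hf : f ∈ bandlimited c T) :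
    ∃ Φ : ℝ → ℂ, Integrable Φ ∧ (∀ w, T < 2 * Real.pi * |w| → Φ w = 0) ∧
      ∀ s : ℝ, complexFourier Φ s = logPullback c f s := by
  obtain ⟨hX, hcont, F, hF, hF0⟩ := hf
  have hh := memLp_logPullback hcont hX
  have hpi : 0 < 2 * Real.pi := by positivity
  set u : Lp ℂ 2 (volume : Measure ℝ) := 𝓕⁻ (hh.toLp _) with hu
  have hae := hF.ae_eq hh (isMellinL2_fourierInv hh)
  have hu0 : ∀ᵐ w : ℝ, T < 2 * Real.pi * |w| → u w = 0 := by
    have h1 : ∀ᵐ t : ℝ, T < |t| → u (t / (2 * Real.pi)) = 0 := by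
      filter_upwards [hae, hF0] with t h1 h2 ht
      rw [← h1, h2 ht]
    filter_upwards [(quasiMeasurePreserving_mul_const hpi.ne').ae h1] with w hw hTw
    have := hw (by rwa [abs_mul, abs_of_pos hpi, mul_comm])
    rwa [mul_div_cancel_right₀ _ hpi.ne'] at this
  let S : Set ℝ := {w | 2 * Real.pi * |w| ≤ T}
  have hS : IsClosed S := isClosed_le (by fun_prop) continuous_const
  have hSfin : volume S < ⊤ := by
    refine (measure_mono (t := Icc (-(T / (2 * Real.pi))) (T / (2 * Real.pi))) ?_).trans_lt
      measure_Icc_lt_top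
    intro w hw
    refine abs_le.1 ((le_div_iff₀ hpi).2 ?_)
    rw [mul_comm]
    exact hw
  have hΦ2 : MemLp (S.indicator u) 2 := (Lp.memLp u).indicator hS.measurableSet
  have hΦ1 : Integrable (S.indicator u) := by
    have : IsFiniteMeasure (volume.restrict S) := ⟨by simpa using hSfin⟩
    exact (integrable_indicator_iff hS.measurableSet).2
      (((Lp.memLp u).restrict S).integrable (by norm_num))
  have hΦu : S.indicator u =ᵐ[volume] u := by
    filter_upwards [hu0] with w hw
    by_cases h : w ∈ S
    · rw [indicator_of_mem h]
    · rw [indicator_of_notMem h, hw (not_le.1 h)]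
  refine ⟨S.indicator u, hΦ1, fun w hw => indicator_of_notMem (s := S) (not_le.2 hw) _, ?_⟩
  have e1 : hΦ2.toLp _ = u := by
    refine Lp.ext (hΦ2.coeFn_toLp.trans hΦu)
  have e2 := coeFn_fourier_toLp hΦ1 hΦ2
  rw [e1, hu, FourierTransform.fourier_fourierInv_eq] at e2
  have e3 := Continuous.ae_eq_iff_eq volume (continuous_fourier hΦ1) (continuous_logPullback hcont)
    |>.1 (e2.symm.trans hh.coeFn_toLp)
  intro s
  rw [complexFourier_ofReal, e3]

theorem mellinBernstein_eq_bandlimited (c : ℝ) {T : ℝ} (hT : 0 < T) :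
    mellinBernstein c T = bandlimited c T := by
  ext f
  constructor
  · rintro ⟨hX, G, g, gp, gm, h⟩
    obtain ⟨C, hC, hb⟩ := h.norm_logPlane_le
    have hd := differentiable_logPlane h.analytic
    have hcont : ContinuousOn f (Ioi 0) := by
      have h1 : ContinuousOn (fun x : ℝ => ((x ^ (-c) : ℝ) : ℂ) * logPlane G (Real.log x))
          (Ioi 0) := by
        refine (Complex.continuous_ofReal.comp_continuousOn
          (continuousOn_id.rpow_const fun x hx => Or.inl (ne_of_gt hx))).mul ?_
        exact (hd.continuous.comp Complex.continuous_ofReal).comp_continuousOn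
          (Real.continuousOn_log.mono fun x hx => ne_of_gt hx)
      refine h1.congr fun x hx => ?_
      have hx0 : 0 < x := hx
      have e : Real.exp (c * Real.log x) = x ^ c := by
        rw [Real.rpow_def_of_pos hx0, mul_comm]
      simp only
      rw [h.logPlane_ofReal, logPullback, Real.exp_log hx0, e, ← mul_assoc, ← Complex.ofReal_mul,
        ← Real.rpow_add hx0]
      simp
    have hh := memLp_logPullback hcont hX
    refine ⟨hX, hcont, _, isMellinL2_fourierInv hh, ?_⟩
    have hpi : 0 < 2 * Real.pi := by positivity
    have h0 := fourierInv_ae_eq_zero_of_exponential_type hd hT.le hC.le hb hh h.logPlane_ofReal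
    filter_upwards [(quasiMeasurePreserving_mul_const (inv_ne_zero hpi.ne')).ae h0] with t ht hTt
    rw [← div_eq_mul_inv] at ht
    refine ht ?_
    rwa [abs_div, abs_of_pos hpi, mul_div_cancel₀ _ hpi.ne']
  · intro hf
    obtain ⟨Φ, hΦ, hs, hΦf⟩ := exists_complexFourier_of_bandlimited hf
    refine ⟨hf.1, _, _, _, _, isBernsteinExtension_of_entire (H := complexFourier Φ)
      (fun z => (hasDerivAt_complexFourier hΦ hs z).differentiableAt) (fun x hx => ?_)
      ⟨(∫ w, ‖Φ w‖) + 1, by positivity, fun z => (norm_complexFourier_le hΦ hs z).trans ?_⟩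
      (tendstoUniformlyOn_complexFourier hΦ hs)⟩
    · rw [hΦf, logPullback, Real.exp_log hx, Real.rpow_def_of_pos hx, mul_comm c]
    · gcongr
      linarith

end MellinPW

end

theorem theorem3 (c T : ℝ) (hT : 0 < T) :
    MellinPW.mellinBernstein c T = MellinPW.bandlimited c T :=
  MellinPW.mellinBernstein_eq_bandlimited c hT
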